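/- Let $A$ be a complex unital Banach algebra (complete, $\|xy\|\le\|x\|\|y\|$, $\|1\|=1$). A state of $A$ is a continuous linear functional $\varphi:A\to\mathbb{C}$ with $\|\varphi\|=\varphi(1)=1$, and the numerical range of $x\in A$ is $W(x)=\{\varphi(x):\varphi \text{ a state of } A\}$. For $\theta\in\mathbb{R}$ let $S_\theta=\{re^{i\rho}: r\ge 0,\ |\rho|\le\theta\}$; $x$ is called sectorial of angle $\theta$ if $W(x)\subseteq S_\theta$. For $x\in A$ with $W(x)$ in the closed right half plane and $0\le t\le 1$, the principal power is $x^t=\lim_{\varepsilon\to0^+}(x+\varepsilon 1)^t$, where $(x+\varepsilon1)^t=\frac{1}{2\pi i}\oint_\Gamma \lambda^t(\lambda 1-x-\varepsilon1)^{-1}\,d\lambda$ is given by the Riesz functional calculus with the principal branch of $\lambda^t$, $\Gamma$ being a positively oriented circle in the open right half plane, with centre on the positive real axis, whose interior contains the spectrum of $x+\varepsilon 1$. If $\theta\le\frac{\pi}{2}$, $x\in A$ is sectorial of angle $\theta$, and $t\in[0,1]$, then $x^t$ is well defined (the limit exists and does not depend on the choice of the circles) and is sectorial of angle $t\theta+(1-t)\frac{\pi}{2}$,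 that is, $W(x^t)\subseteq S_{t\theta+(1-t)\pi/2}$. -/

import Mathlib

open Complex Filter Topology

/-- The states of a unital complex Banach algebra: the functionals `φ` with `‖φ‖ = φ 1 = 1`. -/
def states (A : Type*) [NormedRing A] [NormedAlgebra ℂ A] : Set (A →L[ℂ] ℂ) :=
  {φ | ‖φ‖ = 1 ∧ φ 1 = 1}

/-- The (algebra) numerical range `{φ x : φ a state}`. -/
def numRange {A : Type*} [NormedRing A] [NormedAlgebra ℂ A] (x : A) : Set ℂ :=
  {z | ∃ φ ∈ states A, z = φ x}

/-- The closed sector of all `r * exp (i ρ)` with `r ≥ 0` and `|ρ| ≤ θ`. -/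
def sector (θ : ℝ) : Set ℂ :=
  {z | ∃ r ρ : ℝ, 0 ≤ r ∧ |ρ| ≤ θ ∧ z = (r : ℂ) * Complex.exp ((ρ : ℂ) * Complex.I)}

/-- `x` is sectorial of angle (at most) `θ`: its numerical range lies in the sector. -/
def IsSectorial {A : Type*} [NormedRing A] [NormedAlgebra ℂ A] (x : A) (θ : ℝ) : Prop :=
  numRange x ⊆ sector θ

/-- `b` is the principal `t`-th power of `a` given by the Riesz (holomorphic) functional calculus,
`b = (2πi)⁻¹ ∮ z ^ t (z - a)⁻¹ dz`, along a circle in the open right half plane around the spectrum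
of `a`; such a circle exists exactly when the spectrum lies in the open right half plane. -/
def IsRieszPower {A : Type*} [NormedRing A] [NormedAlgebra ℂ A] (a : A) (t : ℝ) (b : A) : Prop :=
  ∃ c R : ℝ, 0 < R ∧ R < c ∧ spectrum ℂ a ⊆ Metric.ball (c : ℂ) R ∧
    b = (2 * (Real.pi : ℂ) * Complex.I)⁻¹ •
      ∮ z in C((c : ℂ), R), (z ^ (t : ℂ)) • resolvent a z

/-- `y` is the principal power `x ^ t = lim_{ε → 0+} (x + ε 1) ^ t`, the powers on the right being
those of the Riesz functional calculus. -/
def IsPrincipalPower {A : Type*} [NormedRing A] [NormedAlgebra ℂ A] (x : A) (t : ℝ) (y : A) :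
    Prop :=
  ∃ p : ℝ → A, (∀ ε : ℝ, 0 < ε → IsRieszPower (x + algebraMap ℂ A (ε : ℂ)) t (p ε)) ∧
    Tendsto p (𝓝[>] 0) (𝓝 y)

open MeasureTheory Set

/-! Call `x` accretive if `Re φ(x) ≥ 0` for every state `φ`. With `α = π/2 - θ`, sectoriality of
angle `θ` makes both `e^{iα} x` and `e^{-iα} x` accretive, and it suffices that `e^{±iαt} x^t` are
accretive, because `π/2 - tα = tθ + (1-t)π/2`.

For `0 < t < 1` this follows from Balakrishnan's formula `x^t = K ∫ r^(t-1) x (r+x)⁻¹ dr` with `K >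
0`. If `x` is accretive, then `r (r+x)⁻¹` is a contraction, so `x (r+x)⁻¹ = 1 - r (r+x)⁻¹` is
accretive, and so is the integral (`IsAccretive.isAccretive_balakrishnan`). The scalar formula,
inserted under the contour integral, gives `e^{iαt} a^t = K ∫ r^(t-1) e^{iα}a (r + e^{iα}a)⁻¹ dr`
(`IsRieszPower.rotate`). At `α = 0` this shows independence of the circle, and dominated convergence
gives the limit as `ε → 0+`. -/

/-! ### Balakrishnan's formula for scalars -/

theorem one_add_le_mul_norm_add {δ M r : ℝ} {w : ℂ} (hr : 0 ≤ r) (hδ : 0 < δ)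
    (h : δ ≤ ‖(r : ℂ) + w‖) (hM : ‖w‖ ≤ M) :
    1 + r ≤ ((1 + M) / δ + 1) * ‖(r : ℂ) + w‖ := by
  have hM0 : 0 ≤ M := (norm_nonneg w).trans hM
  have h1 : r ≤ ‖(r : ℂ) + w‖ + M := by
    have := norm_sub_le ((r : ℂ) + w) w
    rw [add_sub_cancel_right, Complex.norm_of_nonneg hr] at this
    linarith
  have h2 : 1 + M ≤ (1 + M) / δ * ‖(r : ℂ) + w‖ := by
    rw [div_mul_eq_mul_div, le_div_iff₀ hδ]
    gcongr
  linarith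

theorem integrableOn_rpow_div_add_one {t : ℝ} (ht : t ∈ Ioo (0 : ℝ) 1) :
    IntegrableOn (fun r : ℝ => r ^ (t - 1) / (1 + r)) (Ioi 0) := by
  refine (Real.integrableOn_rpowIntegrand₀₁_Ioi ht zero_le_one).congr_fun ?_ measurableSet_Ioi
  intro r hr
  simp [Real.rpowIntegrand₀₁_eqOn_pow_div ht zero_le_one hr, add_comm]

theorem add_ofReal_ne_zero_of_mem_slitPlane {r : ℝ} {w : ℂ} (hr : 0 ≤ r) (hw : w ∈ slitPlane) :
    (r : ℂ) + w ≠ 0 := by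
  intro h
  have : w = ((-r : ℝ) : ℂ) := by push_cast; linear_combination h
  rw [this, ofReal_mem_slitPlane] at hw
  linarith

theorem continuousOn_rpow_mul_div {t : ℝ} {w : ℂ} (hw : w ∈ slitPlane) :
    ContinuousOn (fun r : ℝ => ((r ^ (t - 1) : ℝ) : ℂ) * (w / (r + w))) (Ioi 0) := by
  have h₀ : ContinuousOn (fun r : ℝ => r ^ (t - 1)) (Ioi 0) :=
    .rpow_const (by fun_prop) fun r hr => .inl (ne_of_gt hr)
  refine (continuous_ofReal.comp_continuousOn h₀).mul (.div (by fun_prop) (by fun_prop) ?_)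
  exact fun r hr => add_ofReal_ne_zero_of_mem_slitPlane (le_of_lt hr) hw

theorem exists_ball_one_add_le {w₀ : ℂ} (hw : w₀ ∈ slitPlane) :
    ∃ ε > 0, ∃ C > 0, ∀ w ∈ Metric.ball w₀ ε, w ∈ slitPlane ∧ ‖w‖ ≤ C ∧
      ∀ r : ℝ, 0 ≤ r → 1 + r ≤ C * ‖(r : ℂ) + w‖ := by
  obtain ⟨d, hd, hball⟩ := Metric.isOpen_iff.1 isOpen_slitPlane w₀ hw
  have hM : 0 ≤ ‖w₀‖ + d := by positivity
  refine ⟨d / 2, by positivity, (1 + (‖w₀‖ + d)) / (d / 2) + 1 + (‖w₀‖ + d), by positivity, ?_⟩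
  intro w hw'
  rw [Metric.mem_ball, dist_eq_norm] at hw'
  have hwM : ‖w‖ ≤ ‖w₀‖ + d := by
    have := norm_add_le (w - w₀) w₀
    rw [sub_add_cancel] at this
    linarith
  refine ⟨hball (by rw [Metric.mem_ball, dist_eq_norm]; linarith), hwM.trans ?_, fun r hr => ?_⟩
  · have : 0 ≤ (1 + (‖w₀‖ + d)) / (d / 2) := by positivity
    linarith
  · have h0 : d ≤ ‖(r : ℂ) + w₀‖ := by
      by_contra! h
      have : -(r : ℂ) ∈ slitPlane := hball (by
        rw [Metric.mem_ball, dist_eq_norm, ← norm_neg]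
        rwa [show -(-(r : ℂ) - w₀) = r + w₀ by ring])
      rw [← ofReal_neg, ofReal_mem_slitPlane] at this
      linarith
    have h1 : d / 2 ≤ ‖(r : ℂ) + w‖ := by
      have := norm_sub_le ((r : ℂ) + w) (w - w₀)
      rw [show (r : ℂ) + w - (w - w₀) = r + w₀ by ring] at this
      linarith
    exact (one_add_le_mul_norm_add hr (by positivity) h1 hwM).trans
      (mul_le_mul_of_nonneg_right (by linarith) (norm_nonneg _))

theorem norm_rpow_mul_div_le {t C r : ℝ} {v w : ℂ} (hr : 0 < r) (hv : ‖v‖ ≤ C)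
    (h : 1 + r ≤ C * ‖(r : ℂ) + w‖) :
    ‖((r ^ (t - 1) : ℝ) : ℂ) * (v / (r + w))‖ ≤ C * C * (r ^ (t - 1) / (1 + r)) := by
  have hC : 0 ≤ C := (norm_nonneg v).trans hv
  have hn : 0 < ‖(r : ℂ) + w‖ := by
    by_contra! h'
    nlinarith
  rw [norm_mul, norm_div, Complex.norm_of_nonneg (by positivity)]
  have : ‖v‖ / ‖(r : ℂ) + w‖ ≤ C * C / (1 + r) := by
    rw [div_le_div_iff₀ hn (by positivity)]
    calc ‖v‖ * (1 + r) ≤ C * (C * ‖(r : ℂ) + w‖) := by gcongr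
      _ = _ := by ring
  calc _ ≤ r ^ (t - 1) * (C * C / (1 + r)) := by gcongr
    _ = _ := by ring

theorem differentiableOn_integral_rpow_mul_div {t : ℝ} (ht : t ∈ Ioo (0 : ℝ) 1) :
    DifferentiableOn ℂ
      (fun w : ℂ => ∫ r in Ioi (0 : ℝ), ((r ^ (t - 1) : ℝ) : ℂ) * (w / (r + w))) slitPlane := by
  intro w₀ hw₀
  obtain ⟨ε, hε, C, hC, hball⟩ := exists_ball_one_add_le hw₀
  have hmem := Metric.ball_mem_nhds w₀ hε
  have hmeas : ∀ w ∈ slitPlane, AEStronglyMeasurable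
      (fun r : ℝ => ((r ^ (t - 1) : ℝ) : ℂ) * (w / (r + w))) (volume.restrict (Ioi 0)) :=
    fun w hw => (continuousOn_rpow_mul_div hw).aestronglyMeasurable measurableSet_Ioi
  have key := hasDerivAt_integral_of_dominated_loc_of_deriv_le
    (μ := volume.restrict (Ioi (0 : ℝ))) (𝕜 := ℂ)
    (F := fun w r => ((r ^ (t - 1) : ℝ) : ℂ) * (w / (r + w)))
    -- The derivative `r / (r + w)²` is split so that `norm_rpow_mul_div_le` applies with the
    -- bounded numerator `r / (r + w)`.
    (F' := fun w r => ((r ^ (t - 1) : ℝ) : ℂ) * ((r / (r + w)) / (r + w)))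
    (bound := fun r => (C + 1 + C * C) * (C + 1 + C * C) * (r ^ (t - 1) / (1 + r)))
    hmem ?_ ?_ ?_ ?_ ?_ ?_
  · exact key.2.differentiableAt.differentiableWithinAt
  · filter_upwards [hmem] with w hw using hmeas w (hball w hw).1
  · refine Integrable.mono' ((integrableOn_rpow_div_add_one ht).const_mul (C * C)) (hmeas w₀ hw₀) ?_
    refine ae_restrict_of_forall_mem measurableSet_Ioi fun r hr => ?_
    obtain ⟨-, h1, h2⟩ := hball w₀ (Metric.mem_ball_self hε)
    exact norm_rpow_mul_div_le hr h1 (h2 r (le_of_lt hr))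
  · have h₀ : ContinuousOn (fun r : ℝ => r ^ (t - 1)) (Ioi 0) :=
      .rpow_const (by fun_prop) fun r hr => .inl (ne_of_gt hr)
    have hne : ∀ r ∈ Ioi (0 : ℝ), (r : ℂ) + w₀ ≠ 0 :=
      fun r hr => add_ofReal_ne_zero_of_mem_slitPlane (le_of_lt hr) hw₀
    exact ContinuousOn.aestronglyMeasurable ((continuous_ofReal.comp_continuousOn h₀).mul
      (.div (.div (by fun_prop) (by fun_prop) hne) (by fun_prop) hne)) measurableSet_Ioi
  · refine ae_restrict_of_forall_mem measurableSet_Ioi fun r hr w hw => ?_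
    obtain ⟨h0, h1, h2⟩ := hball w hw
    have hr' : (0 : ℝ) < r := hr
    have h3 := h2 r hr'.le
    have hn : 0 < ‖(r : ℂ) + w‖ := norm_pos_iff.2 (add_ofReal_ne_zero_of_mem_slitPlane hr'.le h0)
    refine norm_rpow_mul_div_le hr ?_ (h3.trans ?_)
    · rw [norm_div, Complex.norm_of_nonneg hr'.le, div_le_iff₀ hn]
      nlinarith [mul_pos hC hC, mul_pos (mul_pos hC hC) hn]
    · gcongr
      nlinarith
  · exact (integrableOn_rpow_div_add_one ht).const_mul _
  · refine ae_restrict_of_forall_mem measurableSet_Ioi fun r hr w hw => ?_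
    have hne := add_ofReal_ne_zero_of_mem_slitPlane (le_of_lt hr) (hball w hw).1
    have h : HasDerivAt (fun w : ℂ => w / (r + w)) ((1 * (r + w) - w * 1) / (r + w) ^ 2) w :=
      (hasDerivAt_id w).div ((hasDerivAt_id w).const_add (r : ℂ)) hne
    refine (h.congr_deriv ?_).const_mul _
    rw [div_div, ← sq]
    ring

/-- Balakrishnan's formula for the principal power of a complex number off the negative axis. -/
theorem exists_cpow_eq_integral {t : ℝ} (ht : t ∈ Ioo (0 : ℝ) 1) :
    ∃ K : ℝ, 0 < K ∧ ∀ w ∈ slitPlane, w ^ (t : ℂ) =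
      K * ∫ r in Ioi (0 : ℝ), ((r ^ (t - 1) : ℝ) : ℂ) * (w / (r + w)) := by
  refine ⟨(∫ r in Ioi (0 : ℝ), Real.rpowIntegrand₀₁ t r 1)⁻¹,
    inv_pos.2 (Real.integral_rpowIntegrand₀₁_one_pos ht), ?_⟩
  set K := (∫ r in Ioi (0 : ℝ), Real.rpowIntegrand₀₁ t r 1)⁻¹
  have hreal : ∀ x : ℝ, 0 ≤ x → (x : ℂ) ^ (t : ℂ) =
      K * ∫ r in Ioi (0 : ℝ), ((r ^ (t - 1) : ℝ) : ℂ) * (x / (r + x)) := by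
    intro x hx
    rw [← ofReal_cpow hx, Real.rpow_eq_const_mul_integral ht hx, ofReal_mul]
    refine congrArg _ (integral_complex_ofReal.symm.trans ?_)
    refine setIntegral_congr_fun measurableSet_Ioi fun r hr => ?_
    simp only [Real.rpowIntegrand₀₁_eqOn_pow_div ht hx hr]
    push_cast
    ring
  have h1 : AnalyticOnNhd ℂ (fun w : ℂ => w ^ (t : ℂ)) slitPlane :=
    DifferentiableOn.analyticOnNhd
      (fun w hw => (differentiableAt_id.cpow_const hw).differentiableWithinAt) isOpen_slitPlane
  have h2 := ((differentiableOn_integral_rpow_mul_div ht).const_mul (K : ℂ)).analyticOnNhd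
    isOpen_slitPlane
  refine h1.eqOn_of_preconnected_of_frequently_eq (z₀ := 1) h2
    (starConvex_one_slitPlane.isPathConnected one_mem_slitPlane).isConnected.isPreconnected one_mem_slitPlane ?_
  -- Identity theorem: the two sides agree on the reals above `1`, which accumulate at `1`.
  have hlim : Tendsto (fun x : ℝ => (x : ℂ)) (𝓝[>] 1) (𝓝[≠] 1) := by
    refine tendsto_nhdsWithin_iff.2 ⟨?_, ?_⟩
    · exact (continuous_ofReal.tendsto' 1 1 (by simp)).mono_left nhdsWithin_le_nhds
    · filter_upwards [self_mem_nhdsWithin] with x hx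
      simpa using ne_of_gt hx
  refine hlim.frequently (Eventually.frequently ?_)
  filter_upwards [self_mem_nhdsWithin] with x hx
  exact hreal x (zero_le_one.trans (le_of_lt hx))

/-! ### Resolvents of accretive elements -/

section Accretive

variable {A : Type*} [NormedRing A] [NormedAlgebra ℂ A]

/-- `x` is accretive: its numerical range lies in the closed right half plane. -/
def IsAccretive (x : A) : Prop := ∀ φ ∈ states A, 0 ≤ (φ x).re

/-- Balakrishnan's integral `∫₀^∞ r ^ (t - 1) x (r + x)⁻¹ dr`, proportional to `x ^ t`, with
`x (r + x)⁻¹` written as `1 - r (r + x)⁻¹`. -/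
noncomputable def balakrishnan (t : ℝ) (x : A) : A :=
  ∫ r in Ioi (0 : ℝ), ((r ^ (t - 1) : ℝ) : ℂ) • (1 - (r : ℂ) • resolvent (-x) (r : ℂ))

theorem IsAccretive.add_algebraMap {x : A} (hx : IsAccretive x) {ε : ℝ} (hε : 0 ≤ ε) :
    IsAccretive (x + algebraMap ℂ A (ε : ℂ)) := by
  intro φ hφ
  have h := hx φ hφ
  rw [Algebra.algebraMap_eq_smul_one, map_add, map_smul, hφ.2]
  simp only [smul_eq_mul, mul_one, add_re, ofReal_re]
  linarith

theorem isAccretive_one_sub {b : A} (hb : ‖b‖ ≤ 1) : IsAccretive (1 - b) := by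
  intro φ hφ
  have h : (φ b).re ≤ 1 := (re_le_norm _).trans ((φ.le_opNorm b).trans (by rw [hφ.1]; linarith))
  rw [map_sub, hφ.2, sub_re, one_re]
  linarith

theorem one_sub_smul_resolvent_neg {x : A} {l : ℂ} (hl : l ∈ resolventSet ℂ (-x)) :
    1 - l • resolvent (-x) l = x * resolvent (-x) l := by
  have h : (algebraMap ℂ A l - -x) * resolvent (-x) l = 1 := Ring.mul_inverse_cancel _ hl
  rw [sub_neg_eq_add, add_mul, ← Algebra.smul_def] at h
  rw [← h]
  abel

theorem tendsto_add_algebraMap (x : A) :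
    Tendsto (fun ε : ℝ => x + algebraMap ℂ A (ε : ℂ)) (𝓝[>] 0) (𝓝 x) :=
  (Continuous.tendsto' (continuous_const.add ((continuous_algebraMap ℂ A).comp continuous_ofReal))
    _ _ (by simp)).mono_left nhdsWithin_le_nhds

variable [NormOneClass A]

/-- If `g` is a norming functional of `y`, then `a ↦ g (a y) / ‖y‖` is a state; evaluate it at `l +
x`. -/
theorem IsAccretive.re_mul_norm_le {x : A} (hx : IsAccretive x) (l : ℂ) (y : A) :
    l.re * ‖y‖ ≤ ‖(algebraMap ℂ A l + x) * y‖ := by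
  rcases eq_or_ne y 0 with rfl | hy
  · simp
  have hy' : ‖y‖ ≠ 0 := norm_ne_zero_iff.2 hy
  have hy0 : 0 < ‖y‖ := norm_pos_iff.2 hy
  obtain ⟨g, hg, hgy⟩ := exists_dual_vector ℂ y hy'
  let φ : A →L[ℂ] ℂ := ((‖y‖ : ℂ)⁻¹) • g.comp ((ContinuousLinearMap.mul ℂ A).flip y)
  have hφ : ∀ a, φ a = (‖y‖ : ℂ)⁻¹ * g (a * y) := fun a => rfl
  have hyc : (‖y‖ : ℂ) ≠ 0 := ofReal_ne_zero.2 hy'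
  have hφ1 : φ 1 = 1 := by
    rw [hφ, one_mul, hgy]
    exact inv_mul_cancel₀ hyc
  have hb : ∀ a, ‖φ a‖ ≤ ‖y‖⁻¹ * ‖a * y‖ := by
    intro a
    rw [hφ, norm_mul, norm_inv, norm_real, norm_norm]
    have := g.le_opNorm (a * y)
    rw [hg, one_mul] at this
    gcongr
  have hstate : φ ∈ states A := by
    refine ⟨le_antisymm (φ.opNorm_le_bound zero_le_one fun a => (hb a).trans ?_) ?_, hφ1⟩
    · calc ‖y‖⁻¹ * ‖a * y‖ ≤ ‖y‖⁻¹ * (‖a‖ * ‖y‖) := by gcongr; exact norm_mul_le _ _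
        _ = 1 * ‖a‖ := by field_simp
    · have := φ.le_opNorm 1
      rwa [hφ1, norm_one, norm_one, mul_one] at this
  have h1 : l.re ≤ ‖φ (algebraMap ℂ A l + x)‖ := by
    refine le_trans ?_ (re_le_norm _)
    rw [Algebra.algebraMap_eq_smul_one, map_add, map_smul, hφ1]
    simpa using hx φ hstate
  have h2 := h1.trans (hb _)
  rwa [inv_mul_eq_div, le_div_iff₀ hy0] at h2

theorem IsAccretive.norm_resolvent_neg_le {x : A} (hx : IsAccretive x) {l : ℂ} (hl : 0 < l.re)
    (hu : l ∈ resolventSet ℂ (-x)) : ‖resolvent (-x) l‖ ≤ l.re⁻¹ := by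
  have h := hx.re_mul_norm_le l (resolvent (-x) l)
  have h1 : (algebraMap ℂ A l + x) * resolvent (-x) l = 1 := by
    rw [resolvent, ← sub_neg_eq_add]
    exact Ring.mul_inverse_cancel _ hu
  rw [h1, norm_one] at h
  rwa [← one_div, le_div_iff₀ hl, mul_comm]

variable [CompleteSpace A]

theorem IsAccretive.mem_resolventSet_neg {x : A} (hx : IsAccretive x) {l : ℂ} (hl : 0 < l.re) :
    l ∈ resolventSet ℂ (-x) := by
  -- A Neumann series at a real `s > ‖x‖`, where the resolvent has norm at most `1/s`, covers the
  -- disc of centre `s` and radius `s`. The second condition says exactly that `l` lies in it.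
  obtain ⟨s, hs1, hs2⟩ : ∃ s : ℝ, ‖x‖ < s ∧ ‖l‖ ^ 2 / (2 * l.re) < s := by
    obtain ⟨s, hs⟩ := exists_gt (max ‖x‖ (‖l‖ ^ 2 / (2 * l.re)))
    exact ⟨s, (le_max_left _ _).trans_lt hs, (le_max_right _ _).trans_lt hs⟩
  have hs0 : 0 < s := (norm_nonneg x).trans_lt hs1
  have hs : (s : ℂ) ∈ resolventSet ℂ (-x) := by
    refine spectrum.mem_resolventSet_of_norm_lt ?_
    rwa [norm_neg, Complex.norm_of_nonneg hs0.le]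
  have hJ := hx.norm_resolvent_neg_le (l := s) (by simpa using hs0) hs
  rw [ofReal_re] at hJ
  have hd : ‖l - s‖ < s := by
    rw [div_lt_iff₀ (by positivity), Complex.sq_norm, normSq_apply] at hs2
    refine lt_of_pow_lt_pow_left₀ 2 hs0.le ?_
    rw [Complex.sq_norm, normSq_apply, sub_re, sub_im, ofReal_re, ofReal_im]
    nlinarith
  have hsmall : ‖(s - l) • resolvent (-x) (s : ℂ)‖ < 1 := by
    rw [norm_smul, norm_sub_rev]
    calc ‖l - s‖ * ‖resolvent (-x) (s : ℂ)‖ ≤ ‖l - s‖ * s⁻¹ := by gcongr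
      _ < 1 := by rw [← div_eq_mul_inv, div_lt_one hs0]; exact hd
  have hs' : IsUnit (algebraMap ℂ A s - -x) := hs
  have hfac : algebraMap ℂ A l - -x =
      (algebraMap ℂ A s - -x) * (1 - (s - l) • resolvent (-x) (s : ℂ)) := by
    rw [mul_sub, mul_one, mul_smul_comm, resolvent, Ring.mul_inverse_cancel _ hs',
      ← Algebra.algebraMap_eq_smul_one, map_sub]
    abel
  rw [spectrum.mem_resolventSet_iff, hfac]
  exact hs'.mul (isUnit_one_sub_of_norm_lt_one hsmall)

theorem IsAccretive.re_nonneg_of_mem_spectrum {x : A} (hx : IsAccretive x) {z : ℂ}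
    (hz : z ∈ spectrum ℂ x) : 0 ≤ z.re := by
  by_contra! h
  have := hx.mem_resolventSet_neg (l := -z) (by simpa using h)
  rw [resolventSet_neg, Set.neg_mem_neg] at this
  exact hz this

theorem IsAccretive.norm_smul_resolvent_neg_le {x : A} (hx : IsAccretive x) {r : ℝ} (hr : 0 < r) :
    ‖(r : ℂ) • resolvent (-x) (r : ℂ)‖ ≤ 1 := by
  have hr' : 0 < (r : ℂ).re := by simpa using hr
  have h := hx.norm_resolvent_neg_le hr' (hx.mem_resolventSet_neg hr')
  rw [ofReal_re] at h
  rw [norm_smul, Complex.norm_of_nonneg hr.le]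
  calc r * _ ≤ r * r⁻¹ := by gcongr
    _ = 1 := mul_inv_cancel₀ hr.ne'

/-- The bound `2` serves small `r`, and `M / r`, from the form `x (r + x)⁻¹`, serves large `r`. The
result depends on `x` only through `M`, as dominated convergence needs. -/
theorem IsAccretive.norm_one_sub_smul_resolvent_neg_le {x : A} (hx : IsAccretive x) {r M : ℝ}
    (hr : 0 < r) (hM : ‖x‖ ≤ M) :
    ‖1 - (r : ℂ) • resolvent (-x) (r : ℂ)‖ ≤ (2 + M) / (1 + r) := by
  have hr' : 0 < (r : ℂ).re := by simpa using hr
  have h1 : ‖1 - (r : ℂ) • resolvent (-x) (r : ℂ)‖ ≤ 2 := by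
    refine (norm_sub_le _ _).trans ?_
    rw [norm_one]
    linarith [hx.norm_smul_resolvent_neg_le hr]
  have h2 : r * ‖1 - (r : ℂ) • resolvent (-x) (r : ℂ)‖ ≤ M := by
    rw [one_sub_smul_resolvent_neg (hx.mem_resolventSet_neg hr')]
    calc r * ‖x * resolvent (-x) (r : ℂ)‖ = ‖x * (r : ℂ) • resolvent (-x) (r : ℂ)‖ := by
          rw [mul_smul_comm, norm_smul, Complex.norm_of_nonneg hr.le]
      _ ≤ ‖x‖ * ‖(r : ℂ) • resolvent (-x) (r : ℂ)‖ := norm_mul_le _ _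
      _ ≤ M * 1 := by
        gcongr
        · exact (norm_nonneg x).trans hM
        · exact hx.norm_smul_resolvent_neg_le hr
      _ = M := mul_one M
  rw [le_div_iff₀ (by positivity)]
  linarith

theorem IsAccretive.continuousOn_resolvent_neg {x : A} (hx : IsAccretive x) :
    ContinuousOn (fun r : ℝ => resolvent (-x) (r : ℂ)) (Ioi 0) := by
  intro r hr
  have hr' : 0 < (r : ℂ).re := by simpa using hr
  have h := (spectrum.hasDerivAt_resolvent_const_left (hx.mem_resolventSet_neg hr')).continuousAt
  exact (ContinuousAt.comp (f := fun r : ℝ => (r : ℂ)) h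
    continuous_ofReal.continuousAt).continuousWithinAt

theorem IsAccretive.aestronglyMeasurable {x : A} (hx : IsAccretive x) (t : ℝ) :
    AEStronglyMeasurable (fun r : ℝ => ((r ^ (t - 1) : ℝ) : ℂ) •
      (1 - (r : ℂ) • resolvent (-x) (r : ℂ))) (volume.restrict (Ioi 0)) := by
  have h₀ : ContinuousOn (fun r : ℝ => r ^ (t - 1)) (Ioi 0) :=
    .rpow_const (by fun_prop) fun r hr => .inl (ne_of_gt hr)
  exact ContinuousOn.aestronglyMeasurable ((continuous_ofReal.comp_continuousOn h₀).smul
    (continuousOn_const.sub (continuous_ofReal.continuousOn.smul hx.continuousOn_resolvent_neg)))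
    measurableSet_Ioi

theorem IsAccretive.norm_balakrishnan_le {x : A} (hx : IsAccretive x) {r M : ℝ} (t : ℝ)
    (hr : 0 < r) (hM : ‖x‖ ≤ M) :
    ‖((r ^ (t - 1) : ℝ) : ℂ) • (1 - (r : ℂ) • resolvent (-x) (r : ℂ))‖ ≤
      (2 + M) * (r ^ (t - 1) / (1 + r)) := by
  rw [norm_smul, Complex.norm_of_nonneg (by positivity)]
  calc _ ≤ r ^ (t - 1) * ((2 + M) / (1 + r)) := by
        gcongr
        exact hx.norm_one_sub_smul_resolvent_neg_le hr hM
    _ = _ := by ring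

theorem IsAccretive.integrableOn_balakrishnan {x : A} (hx : IsAccretive x) {t : ℝ}
    (ht : t ∈ Ioo (0 : ℝ) 1) :
    IntegrableOn (fun r : ℝ => ((r ^ (t - 1) : ℝ) : ℂ) •
      (1 - (r : ℂ) • resolvent (-x) (r : ℂ))) (Ioi 0) :=
  Integrable.mono' ((integrableOn_rpow_div_add_one ht).const_mul (2 + ‖x‖))
    (hx.aestronglyMeasurable t)
    (ae_restrict_of_forall_mem measurableSet_Ioi fun _ hr => hx.norm_balakrishnan_le t hr le_rfl)

theorem IsAccretive.isAccretive_balakrishnan {x : A} (hx : IsAccretive x) {t : ℝ}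
    (ht : t ∈ Ioo (0 : ℝ) 1) : IsAccretive (balakrishnan t x) := by
  intro φ hφ
  have hi := hx.integrableOn_balakrishnan ht
  rw [balakrishnan, ← φ.integral_comp_comm hi, ← reCLM_apply, ← reCLM.integral_comp_comm (φ.integrable_comp hi)]
  refine setIntegral_nonneg measurableSet_Ioi fun r hr => ?_
  have hr' : (0 : ℝ) < r := hr
  rw [map_smul, reCLM_apply, smul_eq_mul, re_ofReal_mul]
  exact mul_nonneg (by positivity)
    (isAccretive_one_sub (hx.norm_smul_resolvent_neg_le hr') φ hφ)

theorem IsAccretive.tendsto_balakrishnan {x : A} (hx : IsAccretive x) {t : ℝ}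
    (ht : t ∈ Ioo (0 : ℝ) 1) :
    Tendsto (fun ε : ℝ => balakrishnan t (x + algebraMap ℂ A (ε : ℂ))) (𝓝[>] 0)
      (𝓝 (balakrishnan t x)) := by
  unfold balakrishnan
  refine tendsto_integral_filter_of_dominated_convergence
    (fun r => (2 + (‖x‖ + 1)) * (r ^ (t - 1) / (1 + r))) ?_ ?_
    ((integrableOn_rpow_div_add_one ht).const_mul _) ?_
  · filter_upwards [self_mem_nhdsWithin] with ε hε
    exact (hx.add_algebraMap (le_of_lt hε)).aestronglyMeasurable t
  · filter_upwards [Ioo_mem_nhdsGT zero_lt_one] with ε hε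
    refine ae_restrict_of_forall_mem measurableSet_Ioi fun r hr => ?_
    refine (hx.add_algebraMap hε.1.le).norm_balakrishnan_le t hr ((norm_add_le _ _).trans ?_)
    rw [norm_algebraMap', Complex.norm_of_nonneg hε.1.le]
    linarith [hε.2]
  · refine ae_restrict_of_forall_mem measurableSet_Ioi fun r hr => ?_
    have hu : (r : ℂ) ∈ resolventSet ℂ (-x) := hx.mem_resolventSet_neg (by simpa using hr)
    exact ((((spectrum.hasFDerivAt_resolvent hu).continuousAt.tendsto.comp
      (tendsto_add_algebraMap x).neg).const_smul (r : ℂ)).const_sub 1).const_smul _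

end Accretive

/-! ### Contour integrals of the resolvent -/

section Riesz

variable {A : Type*} [NormedRing A] [NormedAlgebra ℂ A]

theorem mem_resolventSet_of_notMem_ball {a : A} {c : ℂ} {R : ℝ}
    (ha : spectrum ℂ a ⊆ Metric.ball c R) {z : ℂ} (hz : z ∉ Metric.ball c R) :
    z ∈ resolventSet ℂ a := by
  by_contra h
  exact hz (ha h)

theorem resolvent_mul_sub_self {a : A} {z : ℂ} (hz : z ∈ resolventSet ℂ a) :
    resolvent a z * (algebraMap ℂ A z - a) = 1 := Ring.inverse_mul_cancel _ hz

theorem smul_resolvent {a : A} {z : ℂ} (hz : z ∈ resolventSet ℂ a) :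
    z • resolvent a z = 1 + resolvent a z * a := by
  rw [← resolvent_mul_sub_self hz, mul_sub, ← Algebra.commutes, ← Algebra.smul_def]
  abel

theorem circleIntegral_integral_swap {c : ℂ} {R : ℝ} (hR : 0 ≤ R) {F : ℂ → ℝ → A} {g : ℝ → ℝ}
    (hF : ContinuousOn (Function.uncurry F) (Metric.sphere c R ×ˢ Ioi 0))
    (hg : IntegrableOn g (Ioi 0))
    (hFg : ∀ z ∈ Metric.sphere c R, ∀ r : ℝ, 0 < r → ‖F z r‖ ≤ g r) :
    (∮ z in C(c, R), ∫ r in Ioi (0 : ℝ), F z r) = ∫ r in Ioi (0 : ℝ), ∮ z in C(c, R), F z r := by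
  simp only [circleIntegral, ← integral_smul]
  refine intervalIntegral_integral_swap ?_
  have hmem : ∀ θ : ℝ, circleMap c R θ ∈ Metric.sphere c R := circleMap_mem_sphere c hR
  have hconst : Integrable (fun _ : ℝ => R) (volume.restrict (uIoc 0 (2 * Real.pi))) :=
    (integrableOn_const (by rw [uIoc, Real.volume_Ioc]; exact ENNReal.ofReal_ne_top))
  refine Integrable.mono' (hconst.mul_prod hg) ?_ ?_
  · rw [Measure.prod_restrict]
    refine ContinuousOn.aestronglyMeasurable ?_ (measurableSet_uIoc.prod measurableSet_Ioi)
    refine ContinuousOn.smul (f := fun p : ℝ × ℝ => deriv (circleMap c R) p.1)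
      (g := fun p : ℝ × ℝ => F (circleMap c R p.1) p.2) ?_ ?_
    · simp only [deriv_circleMap]
      fun_prop
    · exact hF.comp (f := fun p : ℝ × ℝ => (circleMap c R p.1, p.2)) (by fun_prop)
        fun p hp => ⟨hmem p.1, hp.2⟩
  · rw [Measure.prod_restrict]
    refine ae_restrict_of_forall_mem (measurableSet_uIoc.prod measurableSet_Ioi) fun p hp => ?_
    simp only [Function.uncurry, norm_smul, deriv_circleMap, norm_mul, norm_I, mul_one,
      norm_circleMap_zero, abs_of_nonneg hR]
    exact mul_le_mul_of_nonneg_left (hFg _ (hmem p.1) _ hp.2) hR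

variable [CompleteSpace A]

theorem continuousOn_resolvent (a : A) : ContinuousOn (resolvent a) (resolventSet ℂ a) :=
  fun _ hz => (spectrum.hasDerivAt_resolvent_const_left hz).continuousAt.continuousWithinAt

theorem continuousOn_resolvent_sphere {a : A} {c : ℂ} {R : ℝ}
    (ha : spectrum ℂ a ⊆ Metric.ball c R) :
    ContinuousOn (resolvent a : ℂ → A) (Metric.sphere c R) :=
  (continuousOn_resolvent a).mono fun z hz => mem_resolventSet_of_notMem_ball ha (by
    rw [Metric.mem_ball, Metric.mem_sphere.1 hz]
    exact lt_irrefl R)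

/-- Enlarge the circle and compare with `(z - c)⁻¹`: the difference is `(z - c)⁻¹` times `resolvent
a z * (a - c)`, whose second factor vanishes at infinity. -/
theorem circleIntegral_resolvent {a : A} {c : ℂ} {R : ℝ} (hR : 0 < R)
    (ha : spectrum ℂ a ⊆ Metric.ball c R) :
    (∮ z in C(c, R), resolvent a z) = (2 * Real.pi * I : ℂ) • (1 : A) := by
  have hbig : ∀ R', R ≤ R' → (∮ z in C(c, R'), resolvent a z) = ∮ z in C(c, R), resolvent a z := by
    intro R' hR'
    refine circleIntegral_eq_of_differentiable_on_annulus_off_countable hR hR' countable_empty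
      ((continuousOn_resolvent a).mono fun z hz => mem_resolventSet_of_notMem_ball ha hz.2) ?_
    intro z hz
    refine (spectrum.hasDerivAt_resolvent_const_left
      (mem_resolventSet_of_notMem_ball ha fun h => ?_)).differentiableAt
    exact hz.1.2 (Metric.ball_subset_closedBall h)
  rw [← sub_eq_zero, ← norm_le_zero_iff]
  refine le_of_forall_pos_le_add fun ε hε => ?_
  rw [zero_add]
  -- The `+ 1` keeps `D` positive when `a` is the scalar `c`.
  set D := 2 * Real.pi * (‖a - algebraMap ℂ A c‖ + 1) with hD
  have hD0 : 0 < D := by positivity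
  have hev : ∀ᶠ z : ℂ in Bornology.cobounded ℂ, ‖resolvent a z‖ < ε / D := by
    have := (spectrum.resolvent_tendsto_cobounded (𝕜 := ℂ) a).norm
    rw [norm_zero] at this
    exact this.eventually_lt_const (by positivity)
  rw [← comap_norm_atTop, eventually_comap] at hev
  obtain ⟨N, hN⟩ := eventually_atTop.1 hev
  set R' := max R (N + ‖c‖)
  have hRR' : R ≤ R' := le_max_left _ _
  have hR'0 : 0 < R' := hR.trans_le hRR'
  have hmem : ∀ z ∈ Metric.sphere c R', z ∈ resolventSet ℂ a := fun z hz =>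
    mem_resolventSet_of_notMem_ball ha (by
      rw [Metric.mem_ball, Metric.mem_sphere.1 hz]
      exact not_lt.2 hRR')
  have hne : ∀ z ∈ Metric.sphere c R', z - c ≠ 0 := fun z hz =>
    sub_ne_zero.2 (Metric.ne_of_mem_sphere hz hR'0.ne')
  have hc1 : ContinuousOn (resolvent a : ℂ → A) (Metric.sphere c R') :=
    (continuousOn_resolvent a).mono hmem
  have hc2 : ContinuousOn (fun z : ℂ => (z - c)⁻¹ • (1 : A)) (Metric.sphere c R') :=
    (ContinuousOn.inv₀ (by fun_prop) hne).smul continuousOn_const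
  have hone : (∮ z in C(c, R'), (z - c)⁻¹ • (1 : A)) = (2 * Real.pi * I : ℂ) • (1 : A) := by
    rw [circleIntegral.integral_smul_const, circleIntegral.integral_sub_center_inv _ hR'0.ne']
  rw [← hbig R' hRR', ← hone, ← circleIntegral.integral_sub (hc1.circleIntegrable hR'0.le)
    (hc2.circleIntegrable hR'0.le)]
  refine (circleIntegral.norm_integral_le_of_norm_le_const hR'0.le
    (C := R'⁻¹ * (ε / D * ‖a - algebraMap ℂ A c‖)) fun z hz => ?_).trans ?_
  · have hz' : ‖z - c‖ = R' := by rw [← dist_eq_norm]; exact hz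
    have hNz : N ≤ ‖z‖ := by
      have h1 := norm_sub_le z c
      have h2 : N + ‖c‖ ≤ R' := le_max_right _ _
      linarith
    have heq : resolvent a z - (z - c)⁻¹ • (1 : A) =
        (z - c)⁻¹ • (resolvent a z * (a - algebraMap ℂ A c)) := by
      rw [← resolvent_mul_sub_self (hmem z hz), eq_inv_smul_iff₀ (hne z hz), smul_sub,
        smul_inv_smul₀ (hne z hz), Algebra.smul_def, Algebra.commutes, ← mul_sub, map_sub]
      congr 1
      abel
    rw [heq, norm_smul, norm_inv, hz']
    gcongr
    refine (norm_mul_le _ _).trans ?_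
    gcongr
    exact (hN _ hNz z rfl).le
  · calc 2 * Real.pi * R' * (R'⁻¹ * (ε / D * ‖a - algebraMap ℂ A c‖))
        = (R' * R'⁻¹) * (ε / D * (2 * Real.pi * ‖a - algebraMap ℂ A c‖)) := by ring
      _ = ε / D * (2 * Real.pi * ‖a - algebraMap ℂ A c‖) := by
        rw [mul_inv_cancel₀ hR'0.ne', one_mul]
      _ ≤ ε / D * D := by
        gcongr
        rw [hD]
        gcongr
        linarith
      _ = ε := div_mul_cancel₀ _ hD0.ne'

theorem circleIntegral_smul_resolvent {a : A} {c : ℂ} {R : ℝ} (hR : 0 < R)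
    (ha : spectrum ℂ a ⊆ Metric.ball c R) :
    (∮ z in C(c, R), z • resolvent a z) = (2 * Real.pi * I : ℂ) • a := by
  have hc := continuousOn_resolvent_sphere ha
  have hmul : (∮ z in C(c, R), resolvent a z * a) = (∮ z in C(c, R), resolvent a z) * a := by
    have hint : IntervalIntegrable
        (fun θ => deriv (circleMap c R) θ • resolvent a (circleMap c R θ)) volume 0
        (2 * Real.pi) := (hc.circleIntegrable hR.le).out
    have := ((ContinuousLinearMap.mul ℂ A).flip a).intervalIntegral_comp_comm hint
    simpa [circleIntegral, smul_mul_assoc] using this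
  have hcongr : (∮ z in C(c, R), z • resolvent a z) =
      (∮ z in C(c, R), (1 : A)) + ∮ z in C(c, R), resolvent a z * a := by
    rw [← circleIntegral.integral_add (continuousOn_const.circleIntegrable hR.le)
      (ContinuousOn.circleIntegrable hR.le (f := fun z => resolvent a z * a)
        (hc.mul continuousOn_const))]
    refine circleIntegral.integral_congr hR.le fun z hz => smul_resolvent ?_
    exact mem_resolventSet_of_notMem_ball ha (by
      rw [Metric.mem_ball, Metric.mem_sphere.1 hz]
      exact lt_irrefl R)
  have hone : (∮ z in C(c, R), (1 : A)) = 0 :=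
    (diffContOnCl_const (c := (1 : A))).circleIntegral_eq_zero hR.le
  rw [hcongr, hone, hmul, circleIntegral_resolvent hR ha, zero_add, smul_mul_assoc, one_mul]

theorem IsRieszPower.eq_one {a b : A} (h : IsRieszPower a 0 b) : b = 1 := by
  obtain ⟨c, R, hR, -, ha, rfl⟩ := h
  simp only [ofReal_zero, cpow_zero, one_smul]
  rw [circleIntegral_resolvent hR ha, inv_smul_smul₀ two_pi_I_ne_zero]

theorem IsRieszPower.eq_self {a b : A} (h : IsRieszPower a 1 b) : b = a := by
  obtain ⟨c, R, hR, -, ha, rfl⟩ := h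
  simp only [ofReal_one, cpow_one]
  rw [circleIntegral_smul_resolvent hR ha, inv_smul_smul₀ two_pi_I_ne_zero]

/-- The Riesz functional calculus of `z ↦ ω z / (r + ω z)` when the pole is off the disc. -/
theorem circleIntegral_div_smul_resolvent {a : A} {c : ℂ} {R : ℝ} (hR : 0 < R)
    (ha : spectrum ℂ a ⊆ Metric.ball c R) {r ω : ℂ}
    (hne : ∀ z ∈ Metric.closedBall c R, r + ω * z ≠ 0)
    (hr : r ∈ resolventSet ℂ (-(ω • a))) :
    (∮ z in C(c, R), (ω * z / (r + ω * z)) • resolvent a z) =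
      (2 * Real.pi * I : ℂ) • (1 - r • resolvent (-(ω • a)) r) := by
  set v := resolvent (-(ω • a)) r
  have hv : v * (algebraMap ℂ A r + ω • a) = 1 := by
    rw [← sub_neg_eq_add]
    exact resolvent_mul_sub_self hr
  have hc := continuousOn_resolvent_sphere ha
  have hcinv : ContinuousOn (fun z : ℂ => (r + ω * z)⁻¹) (Metric.closedBall c R) :=
    ContinuousOn.inv₀ (by fun_prop) hne
  have hzero : (∮ z in C(c, R), (r + ω * z)⁻¹) = 0 := by
    refine circleIntegral_eq_zero_of_differentiable_on_off_countable hR.le countable_empty hcinv ?_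
    intro z hz
    exact DifferentiableAt.inv (by fun_prop) (hne z (Metric.ball_subset_closedBall hz.1))
  -- By the resolvent identity `h2`, the integrand splits into `(1 - r v)` times the resolvent of
  -- `a` and a multiple of `(r + ω z)⁻¹`, which is holomorphic in the disc and integrates to zero.
  have hcongr : EqOn (fun z : ℂ => (ω * z / (r + ω * z)) • resolvent a z)
      (fun z => (resolvent a z - r • (v * resolvent a z)) + (r + ω * z)⁻¹ • (r * ω) • v)
      (Metric.sphere c R) := by
    intro z hz
    have hz' : z ∈ resolventSet ℂ a := mem_resolventSet_of_notMem_ball ha (by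
      rw [Metric.mem_ball, Metric.mem_sphere.1 hz]
      exact lt_irrefl R)
    have hq := hne z (Metric.sphere_subset_closedBall hz)
    have h1 : (algebraMap ℂ A z - a) * resolvent a z = 1 := Ring.mul_inverse_cancel _ hz'
    have h2 : resolvent a z + ω • v = (r + ω * z) • (v * resolvent a z) := by
      have : (r + ω * z) • (1 : A) =
          (algebraMap ℂ A r + ω • a) + ω • (algebraMap ℂ A z - a) := by
        rw [Algebra.algebraMap_eq_smul_one, Algebra.algebraMap_eq_smul_one]
        module
      calc resolvent a z + ω • v
          = (v * (algebraMap ℂ A r + ω • a)) * resolvent a z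
            + ω • (v * ((algebraMap ℂ A z - a) * resolvent a z)) := by rw [hv, h1, one_mul, mul_one]
        _ = v * (((algebraMap ℂ A r + ω • a) + ω • (algebraMap ℂ A z - a)) * resolvent a z) := by
          simp only [mul_add, add_mul, mul_assoc, smul_mul_assoc, mul_smul_comm]
        _ = _ := by rw [← this, smul_mul_assoc, one_mul, mul_smul_comm]
    have h3 : v * resolvent a z = (r + ω * z)⁻¹ • (resolvent a z + ω • v) := by
      rw [h2, inv_smul_smul₀ hq]
    have h4 : ω * z / (r + ω * z) = 1 - r * (r + ω * z)⁻¹ := by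
      field_simp
      ring
    simp only [h3, h4]
    module
  have hvR : (∮ z in C(c, R), v * resolvent a z) = v * ∮ z in C(c, R), resolvent a z := by
    have hint : IntervalIntegrable
        (fun θ => deriv (circleMap c R) θ • resolvent a (circleMap c R θ)) volume 0
        (2 * Real.pi) := (hc.circleIntegrable hR.le).out
    have := (ContinuousLinearMap.mul ℂ A v).intervalIntegral_comp_comm hint
    simpa [circleIntegral, mul_smul_comm] using this
  have hcv : ContinuousOn (fun z => r • (v * resolvent a z)) (Metric.sphere c R) :=
    (continuousOn_const.mul hc).const_smul r
  have hci : CircleIntegrable (fun z => (r + ω * z)⁻¹ • (r * ω) • v) c R :=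
    ((hcinv.mono Metric.sphere_subset_closedBall).smul continuousOn_const).circleIntegrable hR.le
  have hcd : CircleIntegrable (fun z => resolvent a z - r • (v * resolvent a z)) c R :=
    (hc.sub hcv).circleIntegrable hR.le
  rw [circleIntegral.integral_congr hR.le hcongr, circleIntegral.integral_add hcd hci,
    circleIntegral.integral_smul_const, hzero, zero_smul, add_zero,
    circleIntegral.integral_sub (hc.circleIntegrable hR.le) (hcv.circleIntegrable hR.le),
    circleIntegral.integral_smul, hvR, circleIntegral_resolvent hR ha, mul_smul_comm, mul_one]
  module

end Riesz

/-! ### Rotations of the right half plane -/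

/-- Since `|arg z| < π/2` strictly, `α + arg z` stays in `(-π, π)` and the branch cut is never met.
-/
theorem log_exp_mul_I_mul {α : ℝ} (hα : |α| ≤ Real.pi / 2) {z : ℂ} (hz : 0 < z.re) :
    log (exp (α * I) * z) = α * I + log z ∧ exp (α * I) * z ∈ slitPlane := by
  have hz0 : z ≠ 0 := by
    rintro rfl
    simp at hz
  have harg : |arg z| < Real.pi / 2 := abs_arg_lt_pi_div_two_iff.2 (.inl hz)
  rw [abs_le] at hα
  rw [abs_lt] at harg
  have him : ((α : ℂ) * I + log z).im = α + arg z := by simp [log_im]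
  have hlog : log (exp (α * I) * z) = α * I + log z := by
    rw [← log_exp (x := (α : ℂ) * I + log z) (by rw [him]; linarith) (by rw [him]; linarith),
      exp_add, exp_log hz0]
  refine ⟨hlog, mem_slitPlane_iff_arg.2 ⟨?_, mul_ne_zero (exp_ne_zero _) hz0⟩⟩
  rw [← log_im, hlog, him]
  linarith

theorem exp_mul_I_mul_cpow {α : ℝ} (hα : |α| ≤ Real.pi / 2) {z : ℂ} (hz : 0 < z.re) (t : ℝ) :
    (exp (α * I) * z) ^ (t : ℂ) = exp ((α * t : ℝ) * I) * z ^ (t : ℂ) := by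
  obtain ⟨hlog, hmem⟩ := log_exp_mul_I_mul hα hz
  have hz0 : z ≠ 0 := by
    rintro rfl
    simp at hz
  rw [cpow_def_of_ne_zero (slitPlane_ne_zero hmem), cpow_def_of_ne_zero hz0, hlog, add_mul, exp_add]
  push_cast
  congr 2
  ring

theorem re_ge_of_mem_closedBall {c R : ℝ} {z : ℂ} (hz : z ∈ Metric.closedBall (c : ℂ) R) :
    c - R ≤ z.re := by
  rw [Metric.mem_closedBall, dist_eq_norm] at hz
  have h := (abs_re_le_norm (z - c)).trans hz
  rw [sub_re, ofReal_re, abs_le] at h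
  linarith

/-- Rotate back: `r e^{-iα}` has nonnegative real part. This keeps the poles off the disc, uniformly
in `r`. -/
theorem le_norm_ofReal_add_exp_mul {α : ℝ} (hα : |α| ≤ Real.pi / 2) {r : ℝ} (hr : 0 ≤ r) (z : ℂ) :
    z.re ≤ ‖(r : ℂ) + exp (α * I) * z‖ := by
  have hcos : 0 ≤ Real.cos α := Real.cos_nonneg_of_mem_Icc (abs_le.1 hα)
  have h1 : (r : ℂ) + exp (α * I) * z = exp (α * I) * (r * exp ((-α : ℝ) * I) + z) := by
    have : exp (α * I) * exp ((-α : ℝ) * I) = 1 := by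
      rw [← exp_add]
      simp
    linear_combination (-(r : ℂ)) * this
  rw [h1, norm_mul, norm_exp_ofReal_mul_I, one_mul]
  refine le_trans ?_ (re_le_norm _)
  rw [add_re, re_ofReal_mul, exp_ofReal_mul_I_re, Real.cos_neg]
  nlinarith

/-! ### Powers of algebra elements -/

section Powers

variable {A : Type*} [NormedRing A] [NormedAlgebra ℂ A] [CompleteSpace A]

/-- The rotated circle may leave the right half plane, so the contour stays around the spectrum of
`a` and only the integrand is rotated: `e^{iαt} z^t = (e^{iα} z)^t`. Then the scalar formula and
Fubini apply. -/
theorem circleIntegral_rotated_cpow {t K : ℝ} (ht : t ∈ Ioo (0 : ℝ) 1)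
    (hK : ∀ w ∈ slitPlane, w ^ (t : ℂ) =
      K * ∫ r in Ioi (0 : ℝ), ((r ^ (t - 1) : ℝ) : ℂ) * (w / (r + w)))
    {α : ℝ} (hα : |α| ≤ Real.pi / 2) {a : A} {c R : ℝ} (hR : 0 < R) (hRc : R < c)
    (ha : spectrum ℂ a ⊆ Metric.ball (c : ℂ) R)
    (hres : ∀ r : ℝ, 0 < r → (r : ℂ) ∈ resolventSet ℂ (-(exp (α * I) • a))) :
    exp ((α * t : ℝ) * I) • (∮ z in C((c : ℂ), R), (z ^ (t : ℂ)) • resolvent a z) =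
      (2 * Real.pi * I : ℂ) • (K : ℂ) • balakrishnan t (exp (α * I) • a) := by
  set ω := exp (α * I) with hω
  have hωn : ‖ω‖ = 1 := norm_exp_ofReal_mul_I α
  have hc := continuousOn_resolvent_sphere ha
  have hδ : 0 < c - R := sub_pos.2 hRc
  have hre : ∀ z ∈ Metric.sphere (c : ℂ) R, 0 < z.re := fun z hz =>
    hδ.trans_le (re_ge_of_mem_closedBall (Metric.sphere_subset_closedBall hz))
  obtain ⟨B, hB⟩ := (isCompact_sphere (c : ℂ) R).exists_bound_of_continuousOn hc
  have hnorm : ∀ z ∈ Metric.sphere (c : ℂ) R, ‖ω * z‖ ≤ c + R := by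
    intro z hz
    rw [norm_mul, hωn, one_mul]
    have h1 : ‖z - c‖ = R := by rw [← dist_eq_norm]; exact hz
    have h2 := norm_add_le (z - c) (c : ℂ)
    rw [sub_add_cancel, h1, Complex.norm_of_nonneg (hR.le.trans hRc.le)] at h2
    linarith
  -- The constant of `one_add_le_mul_norm_add` for `δ = c - R`, `M = c + R`, enlarged so that it
  -- also bounds `‖ω * z‖`.
  set C := (1 + (c + R)) / (c - R) + 1 + (c + R) with hC
  have hC1 : c + R ≤ C := by
    have : 0 ≤ (1 + (c + R)) / (c - R) := div_nonneg (by linarith) hδ.le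
    linarith
  have hstep : EqOn (fun z : ℂ => exp ((α * t : ℝ) * I) • ((z ^ (t : ℂ)) • resolvent a z))
      (fun z => (K : ℂ) • ∫ r in Ioi (0 : ℝ),
        (((r ^ (t - 1) : ℝ) : ℂ) * (ω * z / (r + ω * z))) • resolvent a z)
      (Metric.sphere (c : ℂ) R) := by
    intro z hz
    simp only
    rw [smul_smul, ← exp_mul_I_mul_cpow hα (hre z hz), hK _ (log_exp_mul_I_mul hα (hre z hz)).2,
      integral_smul_const, smul_smul]
  rw [← circleIntegral.integral_smul, circleIntegral.integral_congr hR.le hstep,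
    circleIntegral.integral_smul, smul_comm (2 * Real.pi * I : ℂ), balakrishnan, ← integral_smul]
  congr 1
  rw [circleIntegral_integral_swap hR.le (g := fun r => C * C * (r ^ (t - 1) / (1 + r)) * B)]
  · refine setIntegral_congr_fun measurableSet_Ioi fun r hr => ?_
    have hr' : (0 : ℝ) < r := hr
    simp only [mul_smul ((r ^ (t - 1) : ℝ) : ℂ)]
    rw [circleIntegral.integral_smul, circleIntegral_div_smul_resolvent hR ha ?_ (hres r hr),
      smul_comm (2 * Real.pi * I : ℂ)]
    intro z hz
    refine norm_pos_iff.1 ((hδ.trans_le (re_ge_of_mem_closedBall hz)).trans_le ?_)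
    exact le_norm_ofReal_add_exp_mul hα hr'.le z
  · have h₀ : ContinuousOn (fun p : ℂ × ℝ => p.2 ^ (t - 1)) (Metric.sphere (c : ℂ) R ×ˢ Ioi 0) :=
      .rpow_const (by fun_prop) fun p hp => .inl (ne_of_gt hp.2)
    refine ContinuousOn.smul (f := fun p : ℂ × ℝ =>
      ((p.2 ^ (t - 1) : ℝ) : ℂ) * (ω * p.1 / (p.2 + ω * p.1)))
      (g := fun p : ℂ × ℝ => resolvent a p.1) ?_ ?_
    · refine (continuous_ofReal.comp_continuousOn h₀).mul (.div (by fun_prop) (by fun_prop) ?_)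
      intro p hp
      exact add_ofReal_ne_zero_of_mem_slitPlane (le_of_lt hp.2)
        (log_exp_mul_I_mul hα (hre _ hp.1)).2
    · exact hc.comp (f := fun p : ℂ × ℝ => p.1) (by fun_prop) fun p hp => hp.1
  · exact ((integrableOn_rpow_div_add_one ht).const_mul _).mul_const _
  · intro z hz r hr
    rw [norm_smul]
    refine mul_le_mul (norm_rpow_mul_div_le hr ((hnorm z hz).trans hC1) ?_) (hB z hz)
      (norm_nonneg _) ?_
    · refine (one_add_le_mul_norm_add hr.le hδ ?_ (hnorm z hz)).trans ?_
      · exact (re_ge_of_mem_closedBall (Metric.sphere_subset_closedBall hz)).trans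
          (le_norm_ofReal_add_exp_mul hα hr.le z)
      · exact mul_le_mul_of_nonneg_right (by linarith) (norm_nonneg _)
    · have := Real.rpow_nonneg hr.le (t - 1)
      exact mul_nonneg (mul_self_nonneg C) (div_nonneg this (by linarith))

variable [NormOneClass A]

theorem IsRieszPower.rotate {t K : ℝ} (ht : t ∈ Ioo (0 : ℝ) 1)
    (hK : ∀ w ∈ slitPlane, w ^ (t : ℂ) =
      K * ∫ r in Ioi (0 : ℝ), ((r ^ (t - 1) : ℝ) : ℂ) * (w / (r + w)))
    {α : ℝ} (hα : |α| ≤ Real.pi / 2) {a b : A} (h : IsRieszPower a t b)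
    (ha : IsAccretive (exp (α * I) • a)) :
    exp ((α * t : ℝ) * I) • b = (K : ℂ) • balakrishnan t (exp (α * I) • a) := by
  obtain ⟨c, R, hR, hRc, hs, rfl⟩ := h
  rw [smul_comm, circleIntegral_rotated_cpow ht hK hα hR hRc hs
    fun r hr => ha.mem_resolventSet_neg (by simpa using hr), inv_smul_smul₀ two_pi_I_ne_zero]

theorem IsAccretive.exists_circle {x : A} (hx : IsAccretive x) {ε : ℝ} (hε : 0 < ε) :
    ∃ c R : ℝ, 0 < R ∧ R < c ∧
      spectrum ℂ (x + algebraMap ℂ A (ε : ℂ)) ⊆ Metric.ball (c : ℂ) R := by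
  set a := x + algebraMap ℂ A (ε : ℂ) with ha
  have hdiv : 0 ≤ ‖a‖ ^ 2 / ε := by positivity
  -- The spectrum lies in `Re z ≥ ε`, `|z| ≤ ‖a‖`; a circle crossing the axis at `ε / 2` captures
  -- this set once its centre is far enough to the right.
  refine ⟨‖a‖ ^ 2 / ε + ε, ‖a‖ ^ 2 / ε + ε - ε / 2, by linarith, by linarith, fun z hz => ?_⟩
  have hzn : ‖z‖ ≤ ‖a‖ := spectrum.norm_le_norm_of_mem hz
  have hzre : ε ≤ z.re := by
    have h1 : z - ε ∈ spectrum ℂ x := by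
      rw [← spectrum.add_mem_add_iff (s := (ε : ℂ)), sub_add_cancel, add_comm]
      exact hz
    have := hx.re_nonneg_of_mem_spectrum h1
    simpa using this
  rw [Metric.mem_ball, dist_eq_norm]
  refine lt_of_pow_lt_pow_left₀ 2 (by linarith) ?_
  have hz2 : z.re * z.re + z.im * z.im ≤ ‖a‖ ^ 2 := by
    rw [← normSq_apply, ← Complex.sq_norm]
    gcongr
  rw [Complex.sq_norm, normSq_apply, sub_re, sub_im, ofReal_re, ofReal_im]
  have hq : ‖a‖ ^ 2 / ε * ε = ‖a‖ ^ 2 := div_mul_cancel₀ _ hε.ne'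
  generalize ‖a‖ ^ 2 / ε = q at *
  nlinarith [mul_le_mul_of_nonneg_left hzre (show 0 ≤ q + ε by linarith)]

theorem IsAccretive.exists_isRieszPower {x : A} (hx : IsAccretive x) {ε : ℝ} (hε : 0 < ε) (t : ℝ) :
    ∃ b, IsRieszPower (x + algebraMap ℂ A (ε : ℂ)) t b := by
  obtain ⟨c, R, h1, h2, h3⟩ := hx.exists_circle hε
  exact ⟨_, c, R, h1, h2, h3, rfl⟩

theorem IsAccretive.isPrincipalPower_of_tendsto {x : A} (hx : IsAccretive x) {t : ℝ} {p : ℝ → A}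
    (hp : ∀ ε : ℝ, 0 < ε → ∀ b, IsRieszPower (x + algebraMap ℂ A (ε : ℂ)) t b → b = p ε) {y : A}
    (hy : Tendsto p (𝓝[>] 0) (𝓝 y)) (y' : A) : IsPrincipalPower x t y' ↔ y' = y := by
  constructor
  · rintro ⟨q, hq, hlim⟩
    refine tendsto_nhds_unique (hlim.congr' ?_) hy
    filter_upwards [self_mem_nhdsWithin] with ε hε
    exact hp ε hε _ (hq ε hε)
  · rintro rfl
    refine ⟨p, fun ε hε => ?_, hy⟩
    obtain ⟨b, hb⟩ := hx.exists_isRieszPower hε t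
    rwa [← hp ε hε b hb]

theorem IsAccretive.isPrincipalPower_zero_iff {x : A} (hx : IsAccretive x) (y : A) :
    IsPrincipalPower x 0 y ↔ y = 1 :=
  hx.isPrincipalPower_of_tendsto (fun _ _ _ hb => hb.eq_one) tendsto_const_nhds y

theorem IsAccretive.isPrincipalPower_one_iff {x : A} (hx : IsAccretive x) (y : A) :
    IsPrincipalPower x 1 y ↔ y = x :=
  hx.isPrincipalPower_of_tendsto (fun _ _ _ hb => hb.eq_self) (tendsto_add_algebraMap x) y

theorem IsAccretive.exists_isPrincipalPower_iff {x : A} (hx : IsAccretive x) {t : ℝ}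
    (ht : t ∈ Ioo (0 : ℝ) 1) : ∃ y : A, ∀ y', IsPrincipalPower x t y' ↔ y' = y := by
  obtain ⟨K, -, hK⟩ := exists_cpow_eq_integral ht
  refine ⟨_, hx.isPrincipalPower_of_tendsto (fun ε hε b hb => ?_)
    ((hx.tendsto_balakrishnan ht).const_smul (K : ℂ))⟩
  have h := hb.rotate ht hK (α := 0) (by simpa using Real.pi_div_two_pos.le)
    (by simpa using hx.add_algebraMap hε.le)
  simpa only [ofReal_zero, zero_mul, exp_zero, one_smul] using h

theorem IsPrincipalPower.isAccretive_rotate {x y : A} {t : ℝ} (ht : t ∈ Ioo (0 : ℝ) 1)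
    (hy : IsPrincipalPower x t y) {α : ℝ} (hα : |α| ≤ Real.pi / 2)
    (hx : IsAccretive (exp (α * I) • x)) : IsAccretive (exp ((α * t : ℝ) * I) • y) := by
  obtain ⟨K, hK0, hK⟩ := exists_cpow_eq_integral ht
  obtain ⟨p, hp, hlim⟩ := hy
  intro φ hφ
  refine ge_of_tendsto (((continuous_re.comp φ.continuous).tendsto _).comp
    (hlim.const_smul (exp ((α * t : ℝ) * I)))) ?_
  filter_upwards [self_mem_nhdsWithin] with ε hε
  have hε' : (0 : ℝ) < ε := hε
  -- The rotated shift contributes `ε cos α ≥ 0`.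
  have hacc : IsAccretive (exp (α * I) • (x + algebraMap ℂ A (ε : ℂ))) := by
    intro ψ hψ
    have h := hx ψ hψ
    have hcos : 0 ≤ Real.cos α := Real.cos_nonneg_of_mem_Icc (abs_le.1 hα)
    rw [smul_add, map_add, add_re, Algebra.algebraMap_eq_smul_one, smul_smul,
      map_smul ψ (_ * _), hψ.2, smul_eq_mul, mul_one, re_mul_ofReal, exp_ofReal_mul_I_re]
    positivity
  simp only [Function.comp_apply]
  rw [(hp ε hε').rotate ht hK hα hacc, map_smul, smul_eq_mul, re_ofReal_mul]
  exact mul_nonneg hK0.le (hacc.isAccretive_balakrishnan ht φ hφ)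

end Powers

/-! ### Sectors as intersections of half planes, and the conclusion -/

/-- The strict bound keeps `β ± arg z` below `3π/2`, so a nonnegative cosine forces them to be at
most `π/2`. For `β = π/2` the point `z = -1` is a counterexample. -/
theorem mem_sector_of_rotations {z : ℂ} {β : ℝ} (hβ : β < Real.pi / 2)
    (h1 : 0 ≤ (exp ((β : ℝ) * I) * z).re) (h2 : 0 ≤ (exp ((-β : ℝ) * I) * z).re) :
    z ∈ sector (Real.pi / 2 - β) := by
  rcases eq_or_ne z 0 with rfl | hz
  · exact ⟨0, 0, le_rfl, by rw [abs_zero]; linarith, by simp⟩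
  refine ⟨‖z‖, arg z, norm_nonneg z, ?_, (norm_mul_exp_arg_mul_I z).symm⟩
  have hz' : 0 < ‖z‖ := norm_pos_iff.2 hz
  have key : ∀ γ : ℝ, 0 ≤ (exp ((γ : ℝ) * I) * z).re → 0 ≤ Real.cos (γ + arg z) := by
    intro γ h
    have : exp ((γ : ℝ) * I) * z = ‖z‖ * exp ((γ + arg z : ℝ) * I) := by
      conv_lhs => rw [← norm_mul_exp_arg_mul_I z]
      push_cast
      rw [add_mul, exp_add]
      ring
    rw [this, re_ofReal_mul, exp_ofReal_mul_I_re] at h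
    exact nonneg_of_mul_nonneg_right h hz'
  have hp := arg_le_pi z
  have hm := neg_pi_lt_arg z
  rw [abs_le]
  constructor
  · by_contra! h
    have := key (-β) h2
    rw [← Real.cos_neg] at this
    exact this.not_gt (Real.cos_neg_of_pi_div_two_lt_of_lt (by linarith) (by linarith))
  · by_contra! h
    exact (key β h1).not_gt (Real.cos_neg_of_pi_div_two_lt_of_lt (by linarith) (by linarith))

theorem re_rotation_nonneg_of_mem_sector {z : ℂ} {θ α : ℝ} (hz : z ∈ sector θ)
    (hα : |α| ≤ Real.pi / 2 - θ) : 0 ≤ (exp ((α : ℝ) * I) * z).re := by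
  obtain ⟨r, ρ, hr, hρ, rfl⟩ := hz
  have : exp ((α : ℝ) * I) * (r * exp (ρ * I)) = r * exp ((α + ρ : ℝ) * I) := by
    push_cast
    rw [add_mul, exp_add]
    ring
  rw [this, re_ofReal_mul, exp_ofReal_mul_I_re]
  refine mul_nonneg hr (Real.cos_nonneg_of_mem_Icc (abs_le.1 ?_))
  linarith [abs_add_le α ρ]

theorem IsSectorial.isAccretive_rotate {A : Type*} [NormedRing A] [NormedAlgebra ℂ A] {x : A}
    {θ α : ℝ} (hx : IsSectorial x θ) (hα : |α| ≤ Real.pi / 2 - θ) :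
    IsAccretive (exp ((α : ℝ) * I) • x) := by
  intro φ hφ
  rw [map_smul, smul_eq_mul]
  exact re_rotation_nonneg_of_mem_sector (hx ⟨φ, hφ, rfl⟩) hα

theorem corollary6 {A : Type*} [NormedRing A] [NormedAlgebra ℂ A] [CompleteSpace A]
    [NormOneClass A] (x : A) (θ : ℝ) (hθ : θ ≤ Real.pi / 2) (hx : IsSectorial x θ)
    (t : ℝ) (ht0 : 0 ≤ t) (ht1 : t ≤ 1) :
    (∃! y : A, IsPrincipalPower x t y) ∧
      ∀ y : A, IsPrincipalPower x t y →
        IsSectorial y (t * θ + (1 - t) * (Real.pi / 2)) := by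
  have hacc : IsAccretive x := by
    have := hx.isAccretive_rotate (α := 0) (by simpa using hθ)
    simpa using this
  -- Balakrishnan's formula needs `0 < t < 1`; at the endpoints the contour integral is evaluated
  -- directly.
  rcases ht0.eq_or_lt with rfl | ht0
  · simp only [hacc.isPrincipalPower_zero_iff]
    refine ⟨existsUnique_eq, ?_⟩
    rintro _ rfl _ ⟨φ, hφ, rfl⟩
    refine ⟨1, 0, zero_le_one, ?_, by simp [hφ.2]⟩
    simpa using Real.pi_div_two_pos.le
  rcases ht1.eq_or_lt with rfl | ht1
  · simp only [hacc.isPrincipalPower_one_iff]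
    refine ⟨existsUnique_eq, ?_⟩
    rintro _ rfl
    simpa using hx
  have ht : t ∈ Ioo (0 : ℝ) 1 := ⟨ht0, ht1⟩
  obtain ⟨y₀, hy₀⟩ := hacc.exists_isPrincipalPower_iff ht
  refine ⟨by simp only [hy₀, existsUnique_eq], ?_⟩
  rintro y hy _ ⟨φ, hφ, rfl⟩
  -- The state at hand makes the sector nonempty. Hence `α ≤ π/2`, so the rotations are admissible
  -- and `αt < π/2`.
  have hθ0 : 0 ≤ θ := by
    obtain ⟨r, ρ, -, hρ, -⟩ := hx ⟨φ, hφ, rfl⟩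
    exact (abs_nonneg ρ).trans hρ
  set α := Real.pi / 2 - θ with hα
  have hα0 : 0 ≤ α := sub_nonneg.2 hθ
  have hrot : ∀ γ : ℝ, |γ| = α → 0 ≤ (exp ((γ * t : ℝ) * I) * φ y).re := by
    intro γ hγ
    have := hy.isAccretive_rotate ht (by linarith) (hx.isAccretive_rotate hγ.le) φ hφ
    rwa [map_smul, smul_eq_mul] at this
  have h1 := hrot α (abs_of_nonneg hα0)
  have h2 := hrot (-α) (by rw [abs_neg, abs_of_nonneg hα0])
  rw [neg_mul] at h2
  convert mem_sector_of_rotations ?_ h1 h2 using 2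
  · rw [hα]
    ring
  · nlinarith [Real.pi_pos]
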